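/- Let $0<a<b$ be coprime integers, and let $a/b=[0,a_1,\ldots,a_n]=\cfrac{1}{a_1+\cfrac{1}{\ddots+\cfrac1{a_n}}}$ be the regular continued fraction expansion of $a/b$ with positive integers $a_1,\ldots,a_n$ and $n$ odd (where $a_n=1$ is allowed). Let $a^*$ be the inverse of $a$ modulo $b$ with $0<a^*<b$, i.e. $aa^*\equiv 1$ mod $b$, and let $k\ge 0$ be the integer with $aa^*=1+kb$. Put $$T(a,b)=\sum_{j=1}^n(-1)^{j-1}a_j,\qquad D(a,b)=\sum_{j=1}^n a_j.$$ (1) If $a\equiv 1$ mod $4$ or $a^*\equiv 1$ mod $4$, then $T(a,b)\equiv b-k$ mod $4$. (2) If $a\equiv 3$ mod $4$ or $a^*\equiv 3$ mod $4$, then $T(a,b)\equiv 2+k-b$ mod $4$. (3) If $a\equiv 2$ mod $4$ or $a^*\equiv 2$ mod $4$, then $b-k$ is even and $D(a,b)\equiv (b-k)/2$ mod $2$. -/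

import Mathlib

/-- The value of the finite continued fraction `[0, a₁, …, aₙ]`, where `c` is the list
`a₁, …, aₙ` of its partial quotients. -/
def contFracValue : List ℕ → ℚ
  | [] => 0
  | q :: c => 1 / ((q : ℚ) + contFracValue c)

/-- `c = (a₁, …, aₙ)` is the list of partial quotients of the regular continued fraction
expansion `x = [0, a₁, …, aₙ]` that has odd length `n` (the last one may be `1`). -/
structure IsOddExpansion (x : ℚ) (c : List ℕ) : Prop where
  pos : ∀ q ∈ c, 0 < q
  odd : Odd c.length
  value : contFracValue c = x

/-- `T = a₁ - a₂ + a₃ - ⋯ = ∑ (-1)^(j-1) a_j`. -/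
def quotientAltSum (c : List ℕ) : ℤ := (c.map (fun q : ℕ => (q : ℤ))).alternatingSum

/-- `D = a₁ + a₂ + ⋯ + aₙ`. -/
def quotientSum (c : List ℕ) : ℤ := (c.map (fun q : ℕ => (q : ℤ))).sum

theorem exists_expansion (a : ℕ) : ∀ b : ℕ, 0 < a → a < b → ∀ p : ℕ, ∃ c : List ℕ,
    (∀ q ∈ c, 0 < q) ∧ c.length % 2 = p % 2 ∧ contFracValue c = (a : ℚ) / b := by
  induction a using Nat.strong_induction_on with
  | _ a ih =>
    intro b ha hab p
    have hq : 0 < b / a := Nat.div_pos hab.le ha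
    have hb : a * (b / a) + b % a = b := Nat.div_add_mod b a
    have ha' : (a : ℚ) ≠ 0 := by positivity
    have hb' : (b : ℚ) ≠ 0 := by have : 0 < b := by omega
                                 positivity
    have hbq : (a : ℚ) * ((b / a : ℕ) : ℚ) + ((b % a : ℕ) : ℚ) = b := by exact_mod_cast hb
    rcases Nat.eq_zero_or_pos (b % a) with hr | hr
    · have hq2 : 2 ≤ b / a := by
        by_contra h
        have h1 : b / a = 1 := by omega
        rw [h1, hr] at hb
        omega
      rw [hr] at hbq
      have hq' : ((b / a : ℕ) : ℚ) ≠ 0 := by positivity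
      have key : 1 / ((b / a : ℕ) : ℚ) = (a : ℚ) / b := by
        rw [← hbq]; push_cast; field_simp; ring
      rcases Nat.mod_two_eq_zero_or_one p with hp | hp
      · refine ⟨[b / a - 1, 1], by simp; omega, by simp [hp], ?_⟩
        rw [← key]
        simp only [contFracValue]
        rw [Nat.cast_sub (by omega)]
        norm_num
      · exact ⟨[b / a], by simpa using ⟨ha, hab.le⟩, by simp [hp], by simpa [contFracValue] using key⟩
    · obtain ⟨c, hc, hl, hv⟩ := ih (b % a) (Nat.mod_lt b ha) a hr (Nat.mod_lt b ha) (p + 1)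
      refine ⟨b / a :: c, by simpa using ⟨⟨ha, hab.le⟩, hc⟩, by simp; omega, ?_⟩
      rw [contFracValue, hv, ← hbq]
      rw [← hbq] at hb'
      field_simp

/-- Every fraction `0 < a / b < 1` has an expansion of odd length. -/
theorem exists_isOddExpansion {a b : ℕ} (ha : 0 < a) (hab : a < b) :
    ∃ c : List ℕ, IsOddExpansion ((a : ℚ) / b) c := by
  obtain ⟨c, h1, h2, h3⟩ := exists_expansion a b ha hab 1
  exact ⟨c, h1, Nat.odd_iff.2 h2, h3⟩

/-!
For `c = (a₁, …, aₙ)` the product of the matrices `!![0, 1; 1, a_j]` is `!![k, a; s, b]` with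
`a / b = [0, a₁, …, aₙ]`, `0 ≤ s ≤ b` and determinant `(-1)ⁿ`. For odd `n` this gives
`a s = 1 + k b`, so that `s` is the inverse `a*` of `a` modulo `b` and `k` is the integer of the
theorem (`exists_continuants`).

Up to a swap of rows each factor is an elementary matrix, so the product lies in `SL₂(ℤ)` up to that
swap, and its reduction modulo `4` is a product of upper and lower elementary matrices. The group
`SL₂(ℤ/4)` has a character with values in `ℤ/4` that takes `!![1, 1; 0, 1]` to `1` and
`!![1, 0; 1, 1]` to `-1` (`modFourCharacter`). It turns the product into the alternating sum `T`.
Hence `T` modulo `4` is a function of `a, b, a*, k` modulo `4`, and the three cases of the theorem are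
evaluations of that function (`modFourCharacter_of_one`, `modFourCharacter_of_three`,
`modFourCharacter_of_two`). The sum `D` has the parity of `T`.
-/

/-- The character `SL₂(ℤ/4) → ℤ/4` at the matrix `!![p, q; r, t]`, normalised to be `1` at
`!![1, 1; 0, 1]`. It is the exponent of `i` in the sixth power of the multiplier of the Dedekind eta
function; the factor `1 - r ^ 2`, which is `0` for odd `r` and `1` for even `r`, merges the two
cases of the usual formula. Away from determinant `1` the value has no meaning. -/
def modFourCharacter (p q r t : ZMod 4) : ZMod 4 :=
  r * (p + t + 1) + (1 - r ^ 2) * (q * t + (1 - t) * (1 - r))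

/-- The effect of multiplication from the left by `!![1, x; 0, 1]`. -/
theorem modFourCharacter_upper_mul : ∀ x p q r t : ZMod 4, p * t - q * r = 1 →
    modFourCharacter (p + x * r) (q + x * t) r t = x + modFourCharacter p q r t := by
  unfold modFourCharacter
  decide

/-- The effect of multiplication from the left by `!![1, 0; x, 1]`. -/
theorem modFourCharacter_lower_mul : ∀ x p q r t : ZMod 4, p * t - q * r = 1 →
    modFourCharacter p q (r + x * p) (t + x * q) = -x + modFourCharacter p q r t := by
  unfold modFourCharacter
  decide

theorem modFourCharacter_of_one : ∀ p q r t : ZMod 4, p * t - q * r = 1 →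
    t = 1 ∨ p = 1 → modFourCharacter p q r t = q - r := by
  unfold modFourCharacter
  decide

theorem modFourCharacter_of_three : ∀ p q r t : ZMod 4, p * t - q * r = 1 →
    t = 3 ∨ p = 3 → modFourCharacter p q r t = 2 + r - q := by
  unfold modFourCharacter
  decide

/-- Only the parity of the character is determined by `q - r` here. -/
theorem modFourCharacter_of_two : ∀ p q r t : ZMod 4, p * t - q * r = 1 →
    t = 2 ∨ p = 2 → 2 * modFourCharacter p q r t = q - r := by
  unfold modFourCharacter
  decide

theorem quotientAltSum_cons (q : ℕ) (c : List ℕ) :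
    quotientAltSum (q :: c) = q - quotientAltSum c := by
  simp [quotientAltSum, List.alternatingSum_cons]

theorem quotientSum_modEq_quotientAltSum (c : List ℕ) :
    quotientSum c ≡ quotientAltSum c [ZMOD 2] := by
  induction c with
  | nil => rfl
  | cons q c ih =>
    have h : quotientSum (q :: c) = q + quotientSum c := by simp [quotientSum]
    rw [h, quotientAltSum_cons]
    unfold Int.ModEq at *
    omega

/-- The entries of the matrix product `!![k, a; s, b]` of the `!![0, 1; 1, q]` for `q` in `c`.
When `c` has odd length, the rows have to be swapped to obtain determinant `1`. -/
theorem exists_continuants (c : List ℕ) (hc : ∀ q ∈ c, 0 < q) :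
    ∃ k a s b : ℕ, 0 < b ∧ contFracValue c = (a : ℚ) / b ∧ s ≤ b ∧ k + s ≤ a + b ∧
      (Even c.length → k * b = 1 + a * s ∧
        (quotientAltSum c : ZMod 4) = -modFourCharacter k a s b) ∧
      (Odd c.length → a * s = 1 + k * b ∧
        (quotientAltSum c : ZMod 4) = modFourCharacter s b k a) := by
  induction c with
  | nil =>
    refine ⟨1, 0, 0, 1, one_pos, by simp [contFracValue], by simp, by simp, fun _ => ?_, by simp⟩
    simp [quotientAltSum, modFourCharacter]
  | cons q c ih =>
    obtain ⟨k, a, s, b, hb, hv, hsb, hks, he, ho⟩ := ih fun x hx => hc x (by simp [hx])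
    have hq : 0 < q := hc q (by simp)
    have hqs : (q - 1) * s ≤ (q - 1) * b := Nat.mul_le_mul_left _ hsb
    obtain ⟨m, rfl⟩ : ∃ m, q = m + 1 := ⟨q - 1, by omega⟩
    rw [Nat.add_sub_cancel] at hqs
    refine ⟨s, b, k + (m + 1) * s, a + (m + 1) * b, by positivity, ?_, by linarith, by linarith,
      fun hl => ?_, fun hl => ?_⟩
    · have hb' : (b : ℚ) ≠ 0 := by positivity
      rw [contFracValue, hv]
      push_cast
      field_simp
      ring
    · obtain ⟨hd, hT⟩ := ho (by simpa [Nat.even_add_one] using hl)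
      have hd' : (s : ZMod 4) * a - b * k = 1 := by
        have := congrArg (Nat.cast : ℕ → ZMod 4) hd
        push_cast at this
        linear_combination this
      refine ⟨by linarith, ?_⟩
      rw [quotientAltSum_cons]
      push_cast
      rw [hT, modFourCharacter_lower_mul _ _ _ _ _ hd']
      ring
    · obtain ⟨hd, hT⟩ := he (by simpa [Nat.odd_add_one] using hl)
      have hd' : (k : ZMod 4) * b - a * s = 1 := by
        have := congrArg (Nat.cast : ℕ → ZMod 4) hd
        push_cast at this
        linear_combination this
      refine ⟨by linarith, ?_⟩
      rw [quotientAltSum_cons]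
      push_cast
      rw [hT, modFourCharacter_upper_mul _ _ _ _ _ hd']
      ring

theorem coprime_of_mul_eq_one_add {a b s k : ℕ} (h : a * s = 1 + k * b) : a.Coprime b := by
  have h1 : a.gcd b ∣ 1 + k * b := h ▸ (Nat.gcd_dvd_left a b).mul_right s
  exact Nat.dvd_one.1 ((Nat.dvd_add_left ((Nat.gcd_dvd_right a b).mul_left k)).1 h1)

/-- A fraction `a / b` and the bound `s' ≤ b'` determine all four continuants. -/
theorem continuants_unique {a b s k a' b' s' k' : ℕ} (hab : a < b) (ha : 0 < a)
    (hs : s < b) (h : a * s = 1 + k * b) (hb' : 0 < b') (hs' : s' ≤ b')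
    (h' : a' * s' = 1 + k' * b') (hv : (a' : ℚ) / b' = a / b) :
    a' = a ∧ b' = b ∧ s' = s ∧ k' = k := by
  have hb : 0 < b := ha.trans hab
  have hcop := coprime_of_mul_eq_one_add h
  have hcop' := coprime_of_mul_eq_one_add h'
  have hx : a' * b = a * b' := by
    have h1 : (b : ℚ) ≠ 0 := by positivity
    have h2 : (b' : ℚ) ≠ 0 := by positivity
    rw [div_eq_div_iff h2 h1] at hv
    exact_mod_cast hv
  obtain rfl : b' = b := Nat.dvd_antisymm
    (hcop'.symm.dvd_of_dvd_mul_left (hx ▸ dvd_mul_left b' a))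
    (hcop.symm.dvd_of_dvd_mul_left (hx ▸ dvd_mul_left b a'))
  obtain rfl : a' = a := Nat.eq_of_mul_eq_mul_right hb hx
  -- `s' = b'` is excluded because it would make `b'` a divisor of `1`.
  have hlt : s' < b' := by
    refine lt_of_le_of_ne hs' fun hsb => ?_
    have h1 : b' ∣ 1 + k' * b' := h' ▸ hsb ▸ dvd_mul_left s' a'
    have h2 := Nat.dvd_one.1 ((Nat.dvd_add_left (dvd_mul_left b' k')).1 h1)
    omega
  have hmod : a' * s' ≡ a' * s [MOD b'] := by simp [Nat.ModEq, h, h']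
  obtain rfl : s' = s :=
    (Nat.ModEq.cancel_left_of_coprime hcop.symm hmod).eq_of_lt_of_lt hlt hs
  exact ⟨rfl, rfl, rfl, Nat.eq_of_mul_eq_mul_right hb (by omega)⟩

theorem theorem1 (a b aStar k : ℕ) (ha : 0 < a) (hab : a < b)
    (hStar : 0 < aStar) (hStarb : aStar < b) (hk : a * aStar = 1 + k * b)
    (c : List ℕ) (hc : IsOddExpansion ((a : ℚ) / (b : ℚ)) c) :
    ((a ≡ 1 [MOD 4] ∨ aStar ≡ 1 [MOD 4]) →
      quotientAltSum c ≡ (b : ℤ) - (k : ℤ) [ZMOD 4]) ∧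
    ((a ≡ 3 [MOD 4] ∨ aStar ≡ 3 [MOD 4]) →
      quotientAltSum c ≡ 2 + (k : ℤ) - (b : ℤ) [ZMOD 4]) ∧
    ((a ≡ 2 [MOD 4] ∨ aStar ≡ 2 [MOD 4]) →
      (2 : ℤ) ∣ (b : ℤ) - (k : ℤ) ∧
      quotientSum c ≡ ((b : ℤ) - (k : ℤ)) / 2 [ZMOD 2]) := by
  obtain ⟨k', a', s', b', hb', hv, hs', -, -, hodd⟩ := exists_continuants c hc.pos
  obtain ⟨hd', hT⟩ := hodd hc.odd
  obtain ⟨rfl, rfl, rfl, rfl⟩ :=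
    continuants_unique hab ha hStarb hk hb' hs' hd' (hv.symm.trans hc.value)
  have hd : (s' : ZMod 4) * a' - b' * k' = 1 := by
    have := congrArg (Nat.cast : ℕ → ZMod 4) hk
    push_cast at this
    linear_combination this
  have hcast (x r : ℕ) (hx : x ≡ r [MOD 4]) : (x : ZMod 4) = r :=
    (ZMod.natCast_eq_natCast_iff x r 4).2 hx
  refine ⟨fun h => ?_, fun h => ?_, fun h => ?_⟩
  · refine (ZMod.intCast_eq_intCast_iff _ _ 4).1 ?_
    push_cast
    rw [hT]
    exact modFourCharacter_of_one _ _ _ _ hd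
      (h.imp (by simpa using hcast _ 1 ·) (by simpa using hcast _ 1 ·))
  · refine (ZMod.intCast_eq_intCast_iff _ _ 4).1 ?_
    push_cast
    rw [hT]
    exact modFourCharacter_of_three _ _ _ _ hd (h.imp (hcast _ 3) (hcast _ 3))
  · have h2 : 2 * quotientAltSum c ≡ (b' : ℤ) - k' [ZMOD 4] := by
      refine (ZMod.intCast_eq_intCast_iff _ _ 4).1 ?_
      push_cast
      rw [hT]
      exact modFourCharacter_of_two _ _ _ _ hd (h.imp (hcast _ 2) (hcast _ 2))
    have hD := quotientSum_modEq_quotientAltSum c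
    unfold Int.ModEq at *
    omega
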